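/- Let $s\ge 1$ be an integer and let $(g_{\mu\nu})_{0\le\mu,\nu\le s}$ be an invertible real symmetric matrix with inverse $(g^{\mu\nu})$. Let $\mathcal A$ be the cubic Yang–Mills algebra, i.e. the unital associative $\mathbb C$-algebra generated by $\nabla_0,\dots,\nabla_s$ with the relations $$\sum_{\lambda,\mu=0}^{s} g^{\lambda\mu}\,[\nabla_\lambda,[\nabla_\mu,\nabla_\nu]]=0,\qquad \nu=0,\dots,s,$$ graded by giving each $\nabla_\lambda$ degree $1$, so that $\mathcal A=\bigoplus_{n\ge 0}\mathcal A_n$, where $\mathcal A_n$ is the span of the products of $n$ generators. Then every $\mathcal A_n$ is finite-dimensional, and the Poincaré (Hilbert) series $P_{\mathcal A}(t)=\sum_{n\ge 0}\dim_{\mathbb C}(\mathcal A_n)\,t^n$ is, as a formal power series, $$P_{\mathcal A}(t)=\frac{1}{(1-t^2)\,(1-(s+1)t+t^2)}.$$ Moreover, if $s\ge 2$, then $\mathcal A$ has exponential growth: there are real numbers $1<c\le C$ such that $c^n\le\dim_{\mathbb C}\mathcal A_n\le C^n$ for all sufficiently large $n$. If $s=1$, then $\mathcal A$ has polynomial growth: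 there are a real number $C$ and an integer $d\ge 0$ such that $\dim_{\mathbb C}\mathcal A_n\le C(n+1)^d$ for all $n\ge 0$. -/

import Mathlib

namespace YangMills

variable {s : ℕ}

/-- The element `∑ g^{lm} [∇_l, [∇_m, ∇_n]]` of an associative complex algebra, for a family
`x_0, …, x_s` in the role of the `∇_l`; the `g^{lm}` are the entries of the inverse of `g`. -/
noncomputable def cubicElement (g : Matrix (Fin (s + 1)) (Fin (s + 1)) ℝ)
    {B : Type*} [Ring B] [Algebra ℂ B] (x : Fin (s + 1) → B) (n : Fin (s + 1)) : B :=
  ∑ l, ∑ m, ((g⁻¹ l m : ℝ) : ℂ) • ⁅x l, ⁅x m, x n⁆⁆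

/-- The defining relations, on the free algebra on `s + 1` generators. -/
inductive Rel (g : Matrix (Fin (s + 1)) (Fin (s + 1)) ℝ) :
    FreeAlgebra ℂ (Fin (s + 1)) → FreeAlgebra ℂ (Fin (s + 1)) → Prop
  | cubic (n : Fin (s + 1)) : Rel g (cubicElement g (FreeAlgebra.ι ℂ) n) 0

/-- The cubic Yang-Mills algebra: the unital associative complex algebra generated by the `∇_l`
subject to the relations `∑ g^{lm} [∇_l, [∇_m, ∇_n]] = 0`. -/
def CubicAlgebra (g : Matrix (Fin (s + 1)) (Fin (s + 1)) ℝ) : Type :=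
  RingQuot (Rel g)

noncomputable instance (g : Matrix (Fin (s + 1)) (Fin (s + 1)) ℝ) : Ring (CubicAlgebra g) :=
  inferInstanceAs (Ring (RingQuot (Rel g)))

noncomputable instance (g : Matrix (Fin (s + 1)) (Fin (s + 1)) ℝ) : Algebra ℂ (CubicAlgebra g) :=
  inferInstanceAs (Algebra ℂ (RingQuot (Rel g)))

/-- The projection of the free algebra onto the cubic Yang-Mills algebra. -/
noncomputable def proj (g : Matrix (Fin (s + 1)) (Fin (s + 1)) ℝ) :
    FreeAlgebra ℂ (Fin (s + 1)) →ₐ[ℂ] CubicAlgebra g :=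
  RingQuot.mkAlgHom ℂ (Rel g)

/-- The generators `∇_l` of the cubic Yang-Mills algebra. -/
noncomputable def nabla (g : Matrix (Fin (s + 1)) (Fin (s + 1)) ℝ) (l : Fin (s + 1)) :
    CubicAlgebra g :=
  proj g (FreeAlgebra.ι ℂ l)

/-- The homogeneous component of degree `n`: the span of the products of `n` generators. -/
noncomputable def component (g : Matrix (Fin (s + 1)) (Fin (s + 1)) ℝ) (n : ℕ) :
    Submodule ℂ (CubicAlgebra g) :=
  Submodule.span ℂ (Set.range (nabla g)) ^ n

theorem map_cubicElement (g : Matrix (Fin (s + 1)) (Fin (s + 1)) ℝ)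
    {B C : Type*} [Ring B] [Algebra ℂ B] [Ring C] [Algebra ℂ C] (f : B →ₐ[ℂ] C)
    (x : Fin (s + 1) → B) (n : Fin (s + 1)) :
    f (cubicElement g x n) = cubicElement g (fun l => f (x l)) n := by
  simp only [cubicElement, Ring.lie_def, map_sum, map_smul, map_sub, map_mul]

theorem cubicElement_nabla (g : Matrix (Fin (s + 1)) (Fin (s + 1)) ℝ) (n : Fin (s + 1)) :
    cubicElement g (nabla g) n = 0 := by
  have h : proj g (cubicElement g (FreeAlgebra.ι ℂ) n) = proj g 0 :=
    RingQuot.mkAlgHom_rel ℂ (Rel.cubic (g := g) n)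
  rw [map_cubicElement, map_zero] at h
  exact h

theorem nabla_mem (g : Matrix (Fin (s + 1)) (Fin (s + 1)) ℝ) (l : Fin (s + 1)) :
    nabla g l ∈ component g 1 := by
  rw [component, pow_one]
  exact Submodule.subset_span ⟨l, rfl⟩

instance (g : Matrix (Fin (s + 1)) (Fin (s + 1)) ℝ) : SetLike.GradedMonoid (component g) :=
  Submodule.nat_power_gradedMonoid _

/-- The generators, as elements of degree one of the direct sum of the components. -/
noncomputable def nablaOf (g : Matrix (Fin (s + 1)) (Fin (s + 1)) ℝ) (l : Fin (s + 1)) :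
    DirectSum ℕ (fun k => component g k) :=
  DirectSum.of (fun k => component g k) 1 ⟨nabla g l, nabla_mem g l⟩

theorem nablaOf_mul (g : Matrix (Fin (s + 1)) (Fin (s + 1)) ℝ) (a b c : Fin (s + 1)) :
    ∃ h : nabla g a * nabla g b * nabla g c ∈ component g 3, nablaOf g a * nablaOf g b * nablaOf g c
      = DirectSum.lof ℂ ℕ (fun k => component g k) 3 ⟨nabla g a * nabla g b * nabla g c, h⟩ :=
  ⟨SetLike.mul_mem_graded (SetLike.mul_mem_graded (nabla_mem g a) (nabla_mem g b)) (nabla_mem g c),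
    by simp only [nablaOf, DirectSum.of_mul_of]; rfl⟩

theorem cubicElement_of (g : Matrix (Fin (s + 1)) (Fin (s + 1)) ℝ) (n : Fin (s + 1)) :
    cubicElement g (nablaOf g) n = 0 := by
  choose h key using nablaOf_mul g
  have e : cubicElement g (nablaOf g) n = DirectSum.lof ℂ ℕ (fun k => component g k) 3
      (∑ l, ∑ m, ((g⁻¹ l m : ℝ) : ℂ) • ((⟨_, h l m n⟩ - ⟨_, h l n m⟩) - (⟨_, h m n l⟩ - ⟨_, h n m l⟩)))
      := by
    simp only [cubicElement, Ring.lie_def, mul_sub, sub_mul, ← mul_assoc, key]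
    simp only [map_sum, map_smul, map_sub]
  rw [e, ← map_zero (DirectSum.lof ℂ ℕ (fun k => component g k) 3)]
  congr 1
  apply Subtype.ext
  have := cubicElement_nabla g n
  simp only [cubicElement, Ring.lie_def, mul_sub, sub_mul, ← mul_assoc] at this
  simpa only [Submodule.coe_sum, Submodule.coe_smul, Submodule.coe_sub,
    Submodule.coe_zero] using this

/-- The map to the direct sum of the components that makes the decomposition explicit. -/
noncomputable def toDirectSum (g : Matrix (Fin (s + 1)) (Fin (s + 1)) ℝ) :
    CubicAlgebra g →ₐ[ℂ] DirectSum ℕ (fun k => component g k) :=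
  RingQuot.liftAlgHom ℂ ⟨FreeAlgebra.lift ℂ (nablaOf g), by
      rintro _ _ ⟨n⟩
      have h := map_cubicElement g (FreeAlgebra.lift ℂ (nablaOf g)) (FreeAlgebra.ι ℂ) n
      simp only [FreeAlgebra.lift_ι_apply] at h
      exact (h.trans (cubicElement_of g n)).trans (map_zero _).symm⟩

theorem toDirectSum_nabla (g : Matrix (Fin (s + 1)) (Fin (s + 1)) ℝ) (l : Fin (s + 1)) :
    toDirectSum g (nabla g l)
      = DirectSum.of (fun k => component g k) 1 ⟨nabla g l, nabla_mem g l⟩ :=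
  (RingQuot.liftAlgHom_mkAlgHom_apply ℂ _ _ _).trans (FreeAlgebra.lift_ι_apply _ _)

/-- The grading of the cubic Yang-Mills algebra for which the `∇_l` have degree one. -/
noncomputable instance instGradedAlgebra (g : Matrix (Fin (s + 1)) (Fin (s + 1)) ℝ) :
    GradedAlgebra (component g) :=
  GradedAlgebra.ofAlgHom (component g) (toDirectSum g)
    (by
      apply RingQuot.ringQuot_ext'
      ext l
      change DirectSum.coeAlgHom (component g) (toDirectSum g (nabla g l)) = nabla g l
      rw [toDirectSum_nabla]
      simp)
    (by
      rintro n ⟨x, hx⟩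
      dsimp only
      unfold component at hx
      induction hx using Submodule.pow_induction_on_left' with
      | algebraMap r =>
        rw [AlgHom.commutes, DirectSum.algebraMap_apply]; rfl
      | add x y i hx hy ihx ihy =>
        rw [map_add, ihx, ihy, ← map_add]; rfl
      | mem_mul m hm i x hx ih =>
        have hm' : toDirectSum g m = DirectSum.of (fun k => component g k) 1
            ⟨m, by rw [component, pow_one]; exact hm⟩ := by
          induction hm using Submodule.span_induction with
          | mem y hy => obtain ⟨l, rfl⟩ := hy; exact toDirectSum_nabla g l
          | zero => rw [map_zero]; exact (map_zero (DirectSum.of (fun k => component g k) 1)).symm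
          | add a b ha hb iha ihb => rw [map_add, iha, ihb, ← map_add]; rfl
          | smul r a ha iha =>
            rw [map_smul, iha, ← DirectSum.lof_eq_of ℂ, ← map_smul]; rfl
        rw [map_mul, ih, hm', DirectSum.of_mul_of]
        exact DirectSum.of_eq_of_gradedMonoid_eq
          (Sigma.subtype_ext (add_comm _ _) rfl))

end YangMills

section Growth

variable {K A : Type*} [Field K] [Ring A] [Algebra K A]

/-- The Poincaré (Hilbert) series `∑ dim (𝒜 n) tⁿ` of a graded algebra with
finite-dimensional homogeneous components. -/
noncomputable def poincareSeries (𝒜 : ℕ → Submodule K A) [GradedAlgebra 𝒜] : PowerSeries ℚ :=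
  PowerSeries.mk fun n => (Module.finrank K (𝒜 n) : ℚ)

/-- Exponential growth of a graded algebra with finite-dimensional components: for some
`1 < c ≤ C`, the dimensions of the components lie between `c ^ n` and `C ^ n` for large `n`. -/
def HasExponentialGrowth (𝒜 : ℕ → Submodule K A) [GradedAlgebra 𝒜] : Prop :=
  ∃ c C : ℝ, 1 < c ∧ ∀ᶠ n : ℕ in Filter.atTop,
    c ^ n ≤ (Module.finrank K (𝒜 n) : ℝ) ∧ (Module.finrank K (𝒜 n) : ℝ) ≤ C ^ n

/-- Polynomial growth of a graded algebra with finite-dimensional components: the dimensions of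
the components are bounded by a polynomial in the degree. -/
def HasPolynomialGrowth (𝒜 : ℕ → Submodule K A) [GradedAlgebra 𝒜] : Prop :=
  ∃ (C : ℝ) (d : ℕ), ∀ n : ℕ, (Module.finrank K (𝒜 n) : ℝ) ≤ C * ((n : ℝ) + 1) ^ d

end Growth

/-! The algebra is built from a free algebra by two Ore extensions, which give an explicit
homogeneous basis. Over `ℂ` the inverse metric factors as `M * Mᵀ`, so a linear change of generators
turns the relations into `∑ᵢ [yᵢ, [yᵢ, yⱼ]] = 0`. Put `s = m + 1`, `zᵢ = yᵢ₊₁` and `wᵢ = [y₀,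
yᵢ₊₁]`. The relation for `j = 0` becomes `∑ [zᵢ, wᵢ] = 0`, and the others say `[y₀, wᵢ] = -∑ⱼ [zⱼ,
[zⱼ, zᵢ]]`. Hence the algebra is the Ore extension by `y₀` of the algebra on the `zᵢ, wᵢ` with the
single relation `∑ [zᵢ, wᵢ] = 0` (`exists_basis_of_orthonormal`).

That relation in turn expresses `[z₀, w₀]` through the other generators, so the one-relator algebra
is an Ore extension by `z₀` of the free algebra on `w₀` and all iterated brackets of `z₀` with `zᵢ,
wᵢ`, `i ≥ 1` (`SurfaceAlgebra.exists_basis`). In both cases freeness over the powers of the new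
variable comes from `exists_basis_of_ore`: the algebra acts on formal sums `∑ bₙ zⁿ`, and applying
an element to `1` inverts evaluation.

A basis is thus given by words in the letters times `z₀ ^ j * y₀ ^ n`. The letters have series `L =
t² + m (t + t²) / (1 - t)`, words have series `1 / (1 - L)`, and each power contributes `1 / (1 -
t)`; the product is the stated series. Growth follows from the recurrence for its coefficients. -/

/-! ### Ore extensions by a derivation -/

section OreExtension

/-- The finitely supported sequences in `B`, thought of as polynomials `∑ bₙ zⁿ`. -/
def OreSeq (B : Type*) [Ring B] : Type _ := ℕ →₀ B

noncomputable instance (B : Type*) [Ring B] : AddCommGroup (OreSeq B) :=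
  inferInstanceAs (AddCommGroup (ℕ →₀ B))

noncomputable instance (k B : Type*) [Field k] [Ring B] [Algebra k B] : Module k (OreSeq B) :=
  inferInstanceAs (Module k (ℕ →₀ B))

namespace OreSeq

variable {k : Type*} [Field k] {B : Type*} [Ring B] [Algebra k B]

/-- The monomial `b zⁿ`. -/
noncomputable def monomial (n : ℕ) : B →+ OreSeq B :=
  Finsupp.singleAddHom n

variable {M : Type*} [AddCommGroup M] [Module k M]

theorem hom_ext {f g : OreSeq B →ₗ[k] M} (h : ∀ n x, f (monomial n x) = g (monomial n x)) :
    f = g :=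
  Finsupp.lhom_ext h

/-- The linear map with prescribed values on monomials. -/
noncomputable def lift (f : ℕ → B →ₗ[k] M) : OreSeq B →ₗ[k] M :=
  Finsupp.lsum k f

theorem lift_monomial (f : ℕ → B →ₗ[k] M) (n : ℕ) (x : B) : lift f (monomial n x) = f n x :=
  Finsupp.lsum_single k f n x

/-- The linear version of `monomial`. -/
noncomputable def lmonomial (k : Type*) [Field k] {B : Type*} [Ring B] [Algebra k B] (n : ℕ) :
    B →ₗ[k] OreSeq B :=
  Finsupp.lsingle n

theorem lmonomial_apply (n : ℕ) (x : B) : lmonomial k n x = monomial n x := rfl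

theorem exists_basis {ι : Type*} (b : Module.Basis ι k B) :
    ∃ e : Module.Basis (ι × ℕ) k (OreSeq B), ∀ i n, e (i, n) = monomial n (b i) := by
  let e : Module.Basis (Σ _ : ℕ, ι) k (OreSeq B) := Finsupp.basis fun _ : ℕ => b
  have he : ∀ x, e x = monomial x.1 (b x.2) := fun x =>
    congrFun (Finsupp.coe_basis fun _ : ℕ => b) x
  refine ⟨e.reindex ((Equiv.sigmaEquivProd ℕ ι).trans (Equiv.prodComm ℕ ι)), fun i n => ?_⟩
  rw [Module.Basis.reindex_apply, he]
  rfl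

end OreSeq

open OreSeq

/-- Left multiplication by elements of `B`. -/
noncomputable def leftMul (k : Type*) [Field k] (B : Type*) [Ring B] [Algebra k B] :
    B →ₐ[k] Module.End k (OreSeq B) :=
  AlgHom.ofLinearMap
    { toFun := fun x => lift fun n => lmonomial k n ∘ₗ LinearMap.mulLeft k x
      map_add' := fun x y => hom_ext fun n z => by
        simp [lift_monomial, lmonomial_apply, add_mul]
      map_smul' := fun r x => hom_ext fun n z => by
        simp [lift_monomial] }
    (hom_ext fun n z => by simp [lift_monomial, lmonomial_apply])
    (fun x y => hom_ext fun n z => by simp [lift_monomial, lmonomial_apply])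

variable {k : Type*} [Field k] {B : Type*} [Ring B] [Algebra k B]

theorem leftMul_monomial (x y : B) (n : ℕ) :
    leftMul k B x (monomial n y) = monomial n (x * y) :=
  lift_monomial _ _ _

/-- Left multiplication by the variable `z`, where `z b = b z + D b`. -/
noncomputable def shiftAdd (D : B →ₗ[k] B) : Module.End k (OreSeq B) :=
  lift fun n => lmonomial k (n + 1) + lmonomial k n ∘ₗ D

theorem shiftAdd_monomial (D : B →ₗ[k] B) (y : B) (n : ℕ) :
    shiftAdd D (monomial n y) = monomial (n + 1) y + monomial n (D y) :=
  lift_monomial _ _ _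

/-- The Leibniz rule makes the commutation rule of the Ore extension hold for the operators on
sequences; this is what lets relations be checked in the representations below. -/
theorem lie_shiftAdd_leftMul (D : B →ₗ[k] B) (hD : ∀ x y, D (x * y) = D x * y + x * D y) (x : B) :
    ⁅shiftAdd D, leftMul k B x⁆ = leftMul k B (D x) := by
  refine hom_ext fun n y => ?_
  simp [Ring.lie_def, leftMul_monomial, shiftAdd_monomial, hD]

variable {A : Type*} [Ring A] [Algebra k A]

/-- Evaluation `∑ bₙ zⁿ ↦ ∑ φ(bₙ) zⁿ`. -/
noncomputable def evalSeq (φ : B →ₐ[k] A) (z : A) : OreSeq B →ₗ[k] A :=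
  lift fun n => (LinearMap.mulRight k (z ^ n)).comp φ.toLinearMap

theorem evalSeq_monomial (φ : B →ₐ[k] A) (z : A) (n : ℕ) (x : B) :
    evalSeq φ z (monomial n x) = φ x * z ^ n :=
  lift_monomial _ _ _

/-- If `A` is generated by `φ(B)` and `z` with `[z, φ b] = φ (D b)`, and acts on the sequences
`∑ bₙ zⁿ` as the Ore extension does, then `A` is free over `B` on the powers of `z`. -/
theorem exists_basis_of_ore {ι : Type*} (b : Module.Basis ι k B) (D : B →ₗ[k] B)
    (hD : ∀ x y, D (x * y) = D x * y + x * D y) (φ : B →ₐ[k] A) (z : A)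
    (hz : ∀ x, ⁅z, φ x⁆ = φ (D x)) (hgen : Algebra.adjoin k (insert z (Set.range φ)) = ⊤)
    (ρ : A →ₐ[k] Module.End k (OreSeq B)) (hρφ : ∀ x, ρ (φ x) = leftMul k B x)
    (hρz : ρ z = shiftAdd D) :
    ∃ e : Module.Basis (ι × ℕ) k A, ∀ i n, e (i, n) = φ (b i) * z ^ n := by
  have hD1 : D 1 = 0 := by simpa using hD 1 1
  -- Evaluation intertwines `ρ` with left multiplication; it suffices to test generators.
  have key : ∀ a : A, ∀ p, evalSeq φ z (ρ a p) = a * evalSeq φ z p := by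
    intro a
    have ha : a ∈ Algebra.adjoin k (insert z (Set.range φ)) := hgen ▸ Algebra.mem_top
    induction ha using Algebra.adjoin_induction with
    | mem a ha =>
      intro p
      suffices h : evalSeq φ z ∘ₗ ρ a = LinearMap.mulLeft k a ∘ₗ evalSeq φ z from
        LinearMap.congr_fun h p
      refine hom_ext fun n x => ?_
      change evalSeq φ z (ρ a (monomial n x)) = a * evalSeq φ z (monomial n x)
      rcases ha with rfl | ⟨y, rfl⟩
      · have := hz x
        rw [Ring.lie_def, sub_eq_iff_eq_add] at this
        rw [hρz, shiftAdd_monomial, map_add, evalSeq_monomial, evalSeq_monomial, evalSeq_monomial,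
          ← mul_assoc, this, pow_succ', add_mul, mul_assoc, add_comm]
      · rw [hρφ, leftMul_monomial, evalSeq_monomial, evalSeq_monomial, map_mul, mul_assoc]
    | algebraMap r => intro p; simp [Algebra.algebraMap_eq_smul_one]
    | add a c _ _ ha hc => intro p; simp [ha, hc, add_mul]
    | mul a c _ _ ha hc => intro p; simp [ha, hc, mul_assoc]
  have hpow : ∀ n : ℕ, ρ (z ^ n) (monomial 0 1) = monomial n 1 := by
    intro n
    induction n with
    | zero => simp
    | succ n ih => rw [pow_succ', map_mul, Module.End.mul_apply, ih, hρz, shiftAdd_monomial, hD1]; simp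
  -- The inverse of evaluation is `a ↦ ρ a (1)`: `key` gives one composite, `hpow` the other.
  let E : (OreSeq B) ≃ₗ[k] A := LinearEquiv.ofLinearMap (evalSeq φ z)
    ((LinearMap.applyₗ (monomial 0 (1 : B))).comp ρ.toLinearMap)
    (by
      ext a
      change evalSeq φ z (ρ a (monomial 0 1)) = a
      rw [key, evalSeq_monomial]; simp)
    (by
      refine hom_ext fun n x => ?_
      change ρ (evalSeq φ z (monomial n x)) (monomial 0 1) = monomial n x
      rw [evalSeq_monomial, map_mul, Module.End.mul_apply, hpow, hρφ, leftMul_monomial, mul_one])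
  obtain ⟨e, he⟩ := OreSeq.exists_basis b
  refine ⟨e.map E, fun i n => ?_⟩
  rw [Module.Basis.map_apply, he]
  exact evalSeq_monomial φ z n (b i)

/-- A section of the square-zero extension is a derivation. -/
theorem exists_derivation_of_algHom (Ψ : B →ₐ[k] TrivSqZeroExt B B)
    (hΨ : ∀ x, (Ψ x).fst = x) :
    ∃ D : B →ₗ[k] B, (∀ x y, D (x * y) = D x * y + x * D y) ∧ ∀ x, D x = (Ψ x).snd := by
  refine ⟨(TrivSqZeroExt.sndHom B B).restrictScalars k ∘ₗ Ψ.toLinearMap, fun x y => ?_, fun x => rfl⟩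
  simp [hΨ, add_comm]

/-- A derivation is a section of the square-zero extension, and freeness lets such a section be
chosen arbitrarily on generators. -/
theorem exists_derivation_freeAlgebra {X : Type*} (f : X → FreeAlgebra k X) :
    ∃ D : FreeAlgebra k X →ₗ[k] FreeAlgebra k X, (∀ x y, D (x * y) = D x * y + x * D y) ∧
      ∀ x, D (FreeAlgebra.ι k x) = f x := by
  let Ψ : FreeAlgebra k X →ₐ[k] TrivSqZeroExt (FreeAlgebra k X) (FreeAlgebra k X) :=
    FreeAlgebra.lift k fun x => TrivSqZeroExt.inl (FreeAlgebra.ι k x) + TrivSqZeroExt.inr (f x)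
  have hΨ : (TrivSqZeroExt.fstHom k _ _).comp Ψ = AlgHom.id k _ := by
    ext x; simp [Ψ]
  obtain ⟨D, h1, h2⟩ := exists_derivation_of_algHom Ψ (fun x => DFunLike.congr_fun hΨ x)
  exact ⟨D, h1, fun x => by simp [h2, Ψ]⟩

/-- Two derivations along `φ` that agree on generators agree. -/
theorem lie_eq_of_adjoin_eq_top (D : B →ₗ[k] B) (hD : ∀ x y, D (x * y) = D x * y + x * D y)
    (φ : B →ₐ[k] A) (z : A) {S : Set B} (hS : Algebra.adjoin k S = ⊤)
    (h : ∀ x ∈ S, ⁅z, φ x⁆ = φ (D x)) (x : B) : ⁅z, φ x⁆ = φ (D x) := by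
  have hD1 : D 1 = 0 := by simpa using hD 1 1
  have hx : x ∈ Algebra.adjoin k S := hS ▸ Algebra.mem_top
  induction hx using Algebra.adjoin_induction with
  | mem x hx => exact h x hx
  | algebraMap r =>
    rw [AlgHom.commutes, Ring.lie_def, Algebra.commutes, Algebra.algebraMap_eq_smul_one (A := B),
      map_smul, hD1]
    simp
  | add x y _ _ hx hy => rw [map_add, map_add, map_add, ← hx, ← hy]; simp only [Ring.lie_def]; noncomm_ring
  | mul x y _ _ hx hy =>
    rw [hD, map_add, map_mul, map_mul, map_mul, ← hx, ← hy]
    simp only [Ring.lie_def]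
    noncomm_ring

end OreExtension

/-! ### Commutator identities -/

section RingLie

variable {k : Type*} [Field k] {A C : Type*} [Ring A] [Algebra k A] [Ring C] [Algebra k C]

theorem algHom_lie (f : A →ₐ[k] C) (a b : A) : f ⁅a, b⁆ = ⁅f a, f b⁆ := by
  simp [Ring.lie_def]

theorem algHom_iterate_lie (f : A →ₐ[k] C) (a b : A) (n : ℕ) :
    f ((fun x => ⁅a, x⁆)^[n] b) = (fun x => ⁅f a, x⁆)^[n] (f b) :=
  Function.Semiconj.iterate_right (f := f) (fun x => algHom_lie f a x) n b

theorem ring_lie_self (a : A) : ⁅a, a⁆ = 0 := sub_self _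

theorem ring_lie_skew (a b : A) : ⁅a, b⁆ = -⁅b, a⁆ := (neg_sub _ _).symm

theorem ring_lie_neg (a b : A) : ⁅a, -b⁆ = -⁅a, b⁆ := by
  simp only [Ring.lie_def]; noncomm_ring

theorem ring_lie_smul (c : k) (a b : A) : ⁅a, c • b⁆ = c • ⁅a, b⁆ := by
  simp [Ring.lie_def, smul_sub]

theorem ring_lie_zero (a : A) : ⁅a, (0 : A)⁆ = 0 := by simp [Ring.lie_def]

theorem ring_lie_sum {ι : Type*} (t : Finset ι) (a : A) (b : ι → A) :
    ⁅a, ∑ i ∈ t, b i⁆ = ∑ i ∈ t, ⁅a, b i⁆ := by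
  simp [Ring.lie_def, Finset.mul_sum, Finset.sum_mul]

/-- By the Jacobi identity, the summand plus the one with `i` and `j` exchanged is `[[zᵢ, zⱼ], [zⱼ,
zᵢ]] = 0`, so twice the sum vanishes. This is the compatibility of the derivation `zᵢ ↦ wᵢ ↦ -∑ⱼ
[zⱼ, [zⱼ, zᵢ]]` with `∑ [zᵢ, wᵢ] = 0`. -/
theorem sum_sum_lie_lie_lie_eq_zero [CharZero k] {ι : Type*} [Fintype ι] (z : ι → A) :
    ∑ i, ∑ j, ⁅z i, ⁅z j, ⁅z j, z i⁆⁆⁆ = 0 := by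
  have h : (2 : k) • ∑ i, ∑ j, ⁅z i, ⁅z j, ⁅z j, z i⁆⁆⁆ = 0 := by
    rw [two_smul]
    nth_rewrite 2 [Finset.sum_comm]
    simp only [← Finset.sum_add_distrib]
    refine Finset.sum_eq_zero fun i _ => Finset.sum_eq_zero fun j _ => ?_
    simp only [Ring.lie_def]
    noncomm_ring
  exact (smul_eq_zero.mp h).resolve_left two_ne_zero

end RingLie

section FreeAlgebraBasis

variable {k X : Type*} [Field k]

theorem basisFreeMonoid_apply (w : FreeMonoid X) :
    FreeAlgebra.basisFreeMonoid k X w = FreeMonoid.lift (FreeAlgebra.ι k) w := by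
  have h : FreeAlgebra.basisFreeMonoid k X w
      = FreeAlgebra.equivMonoidAlgebraFreeMonoid.symm (MonoidAlgebra.of k _ w) := rfl
  rw [h]
  simp [FreeAlgebra.equivMonoidAlgebraFreeMonoid]

end FreeAlgebraBasis

/-! ### The one-relator algebra on `zᵢ, wᵢ` -/

namespace SurfaceAlgebra

/-- The single relation `∑ [zᵢ, wᵢ] = 0`, where `zᵢ = (i, false)` and `wᵢ = (i, true)`. -/
inductive Rel (m : ℕ) : FreeAlgebra ℂ (Fin (m + 1) × Bool) →
    FreeAlgebra ℂ (Fin (m + 1) × Bool) → Prop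
  | sum : Rel m (∑ i, ⁅FreeAlgebra.ι ℂ (i, false), FreeAlgebra.ι ℂ (i, true)⁆) 0

end SurfaceAlgebra

/-- The algebra generated by `zᵢ`, `wᵢ`, `0 ≤ i ≤ m`, with the relation `∑ [zᵢ, wᵢ] = 0`. -/
def SurfaceAlgebra (m : ℕ) : Type := RingQuot (SurfaceAlgebra.Rel m)

noncomputable instance (m : ℕ) : Ring (SurfaceAlgebra m) :=
  inferInstanceAs (Ring (RingQuot (SurfaceAlgebra.Rel m)))

noncomputable instance (m : ℕ) : Algebra ℂ (SurfaceAlgebra m) :=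
  inferInstanceAs (Algebra ℂ (RingQuot (SurfaceAlgebra.Rel m)))

namespace SurfaceAlgebra

variable {m : ℕ}

/-- The projection of the free algebra. -/
noncomputable def proj (m : ℕ) : FreeAlgebra ℂ (Fin (m + 1) × Bool) →ₐ[ℂ] SurfaceAlgebra m :=
  RingQuot.mkAlgHom ℂ (Rel m)

/-- The generators. -/
noncomputable def gen (x : Fin (m + 1) × Bool) : SurfaceAlgebra m :=
  proj m (FreeAlgebra.ι ℂ x)

theorem sum_lie_gen : ∑ i, ⁅gen (m := m) (i, false), gen (i, true)⁆ = 0 := by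
  have h : proj m _ = proj m _ := RingQuot.mkAlgHom_rel ℂ (Rel.sum (m := m))
  simp only [map_sum, algHom_lie, map_zero] at h
  exact h

theorem exists_lift {E : Type*} [Ring E] [Algebra ℂ E] (f : Fin (m + 1) × Bool → E)
    (hf : ∑ i, ⁅f (i, false), f (i, true)⁆ = 0) :
    ∃ φ : SurfaceAlgebra m →ₐ[ℂ] E, ∀ x, φ (gen x) = f x := by
  refine ⟨RingQuot.liftAlgHom ℂ ⟨FreeAlgebra.lift ℂ f, ?_⟩, fun x => ?_⟩
  · rintro _ _ ⟨⟩
    simpa only [map_sum, algHom_lie, FreeAlgebra.lift_ι_apply, map_zero] using hf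
  · exact (RingQuot.liftAlgHom_mkAlgHom_apply ℂ _ _ _).trans (FreeAlgebra.lift_ι_apply _ _)

theorem algHom_ext {E : Type*} [Ring E] [Algebra ℂ E] {φ ψ : SurfaceAlgebra m →ₐ[ℂ] E}
    (h : ∀ x, φ (gen x) = ψ (gen x)) : φ = ψ := by
  apply RingQuot.ringQuot_ext'
  ext x
  exact h x

theorem adjoin_range_gen : Algebra.adjoin ℂ (Set.range (gen (m := m))) = ⊤ := by
  have : gen (m := m) = proj m ∘ FreeAlgebra.ι ℂ := rfl
  rw [this, Set.range_comp, ← AlgHom.map_adjoin, FreeAlgebra.adjoin_range_ι, Algebra.map_top,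
    AlgHom.range_eq_top]
  exact RingQuot.mkAlgHom_surjective ℂ _

/-- The hypothesis is the linearized relation, that is, the second component of the relation in the
square-zero extension. -/
theorem exists_derivation (f : Fin (m + 1) × Bool → SurfaceAlgebra m)
    (hf : ∑ i, (⁅f (i, false), gen (i, true)⁆ + ⁅gen (i, false), f (i, true)⁆) = 0) :
    ∃ D : SurfaceAlgebra m →ₗ[ℂ] SurfaceAlgebra m, (∀ x y, D (x * y) = D x * y + x * D y) ∧
      ∀ x, D (gen x) = f x := by
  obtain ⟨Ψ, hΨ⟩ := exists_lift (E := TrivSqZeroExt (SurfaceAlgebra m) (SurfaceAlgebra m))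
    (fun x => TrivSqZeroExt.inl (gen x) + TrivSqZeroExt.inr (f x)) (by
      refine TrivSqZeroExt.ext ?_ ?_
      · have := sum_lie_gen (m := m)
        simp only [Ring.lie_def] at this
        simpa [Ring.lie_def, TrivSqZeroExt.fst_sum] using this
      · rw [TrivSqZeroExt.snd_sum, TrivSqZeroExt.snd_zero, ← hf]
        refine Finset.sum_congr rfl fun i _ => ?_
        simp only [Ring.lie_def, TrivSqZeroExt.snd_sub, TrivSqZeroExt.snd_mul,
          TrivSqZeroExt.fst_add, TrivSqZeroExt.snd_add, TrivSqZeroExt.fst_inl,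
          TrivSqZeroExt.fst_inr, TrivSqZeroExt.snd_inl, TrivSqZeroExt.snd_inr, smul_eq_mul,
          MulOpposite.smul_eq_mul_unop, MulOpposite.unop_op]
        noncomm_ring)
  have hfst : (TrivSqZeroExt.fstHom ℂ _ _).comp Ψ = AlgHom.id ℂ _ :=
    algHom_ext fun x => by simp [hΨ]
  obtain ⟨D, h1, h2⟩ := exists_derivation_of_algHom Ψ (fun x => DFunLike.congr_fun hfst x)
  exact ⟨D, h1, fun x => by simp [h2, hΨ]⟩

end SurfaceAlgebra

/-- Free generators of the ideal of the free algebra complementary to `z₀`: the letter `none` is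
`w₀`, and `(i, ε, n)` is the `n`-fold bracket of `z₀` with `zᵢ₊₁` (`ε = false`) or `wᵢ₊₁`
(`ε = true`). -/
abbrev Letter (m : ℕ) : Type := Option (Fin m × Bool × ℕ)

/-- The value of a letter, for given values of the generators `z` and `w`. -/
def Letter.value {m : ℕ} {E : Type*} [Ring E] (f : Fin (m + 1) × Bool → E) : Letter m → E
  | none => f (0, true)
  | some (i, ε, n) => (fun x => ⁅f (0, false), x⁆)^[n] (f (i.succ, ε))

theorem Letter.map_value {m : ℕ} {E E' : Type*} [Ring E] [Ring E'] [Algebra ℂ E] [Algebra ℂ E']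
    (φ : E →ₐ[ℂ] E') (f : Fin (m + 1) × Bool → E) (x : Letter m) :
    φ (x.value f) = x.value (fun y => φ (f y)) := by
  rcases x with _ | ⟨i, ε, n⟩
  · rfl
  · exact algHom_iterate_lie φ _ _ n

namespace SurfaceAlgebra

/-- The algebra is the Ore extension of a free algebra by `z₀`: bracketing with `z₀` raises the
index of a letter, except that it sends `w₀` to `-∑ [zᵢ, wᵢ]` over `i ≥ 1`. -/
theorem exists_basis (m : ℕ) :
    ∃ e : Module.Basis (FreeMonoid (Letter m) × ℕ) ℂ (SurfaceAlgebra m),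
      ∀ u n, e (u, n) = FreeMonoid.lift (Letter.value gen) u * gen (0, false) ^ n := by
  let ι' : Letter m → FreeAlgebra ℂ (Letter m) := FreeAlgebra.ι ℂ
  obtain ⟨D, hD, hDι⟩ := exists_derivation_freeAlgebra (k := ℂ) (X := Letter m) fun x =>
    match x with
    | none => - ∑ i : Fin m, ⁅ι' (some (i, false, 0)), ι' (some (i, true, 0))⁆
    | some (i, ε, n) => ι' (some (i, ε, n + 1))
  let φ : FreeAlgebra ℂ (Letter m) →ₐ[ℂ] SurfaceAlgebra m :=
    FreeAlgebra.lift ℂ (Letter.value gen)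
  have hφ : ∀ x, φ (ι' x) = Letter.value gen x := FreeAlgebra.lift_ι_apply _
  -- `z₀` acts as the Ore variable, and every other generator as left multiplication by its letter.
  let act : Fin (m + 1) × Bool → Module.End ℂ (OreSeq (FreeAlgebra ℂ (Letter m))) := fun x =>
    Fin.cases (if x.2 then leftMul ℂ _ (ι' none) else shiftAdd D)
      (fun i => leftMul ℂ _ (ι' (some (i, x.2, 0)))) x.1
  have hact : ∑ i, ⁅act (i, false), act (i, true)⁆ = 0 := by
    rw [Fin.sum_univ_succ]
    have h0 : ⁅act (0, false), act (0, true)⁆ = leftMul ℂ _ (D (ι' none)) :=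
      lie_shiftAdd_leftMul D hD _
    have h1 : ∀ i : Fin m, ⁅act (i.succ, false), act (i.succ, true)⁆
        = leftMul ℂ _ ⁅ι' (some (i, false, 0)), ι' (some (i, true, 0))⁆ :=
      fun i => (algHom_lie _ _ _).symm
    simp only [h0, h1]
    rw [hDι, ← map_sum, ← map_add, neg_add_cancel, map_zero]
  obtain ⟨ρ, hρ⟩ := exists_lift act hact
  have hρz : ρ (gen (0, false)) = shiftAdd D := hρ _
  have hρφ : ∀ x, ρ (φ x) = leftMul ℂ _ x := by
    have : ρ.comp φ = leftMul ℂ _ := by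
      ext1
      funext x
      change ρ (φ (ι' x)) = leftMul ℂ _ (ι' x)
      rw [hφ, Letter.map_value]
      rcases x with _ | ⟨i, ε, n⟩
      · exact hρ _
      · simp only [Letter.value, hρz]
        induction n with
        | zero => exact hρ _
        | succ n ih =>
          rw [Function.iterate_succ_apply', ih, lie_shiftAdd_leftMul D hD, hDι]
    exact fun x => DFunLike.congr_fun this x
  have hz : ∀ x, ⁅gen (m := m) (0, false), φ x⁆ = φ (D x) := by
    refine lie_eq_of_adjoin_eq_top D hD φ _ (FreeAlgebra.adjoin_range_ι ℂ _) ?_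
    rintro _ ⟨x, rfl⟩
    change ⁅_, φ (ι' x)⁆ = φ (D (ι' x))
    rw [hφ, hDι]
    rcases x with _ | ⟨i, ε, n⟩
    · simp only [map_neg, map_sum, algHom_lie, hφ]
      have := sum_lie_gen (m := m)
      rw [Fin.sum_univ_succ] at this
      exact eq_neg_of_add_eq_zero_left this
    · simp only [hφ, Letter.value]
      rw [Function.iterate_succ_apply']
  have hgen : Algebra.adjoin ℂ (insert (gen (0, false)) (Set.range φ)) = ⊤ := by
    rw [eq_top_iff, ← adjoin_range_gen]
    refine Algebra.adjoin_mono ?_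
    rintro _ ⟨⟨i, ε⟩, rfl⟩
    refine Fin.cases ?_ (fun i => ?_) i
    · cases ε
      · exact Or.inl rfl
      · exact Or.inr ⟨ι' none, hφ _⟩
    · exact Or.inr ⟨ι' (some (i, ε, 0)), hφ _⟩
  obtain ⟨e, he⟩ := exists_basis_of_ore (FreeAlgebra.basisFreeMonoid ℂ (Letter m)) D hD φ
    (gen (0, false)) hz hgen ρ hρφ hρz
  refine ⟨e, fun u n => ?_⟩
  rw [he, basisFreeMonoid_apply]
  congr 1
  change ((φ : FreeAlgebra ℂ (Letter m) →* SurfaceAlgebra m).comp (FreeMonoid.lift (FreeAlgebra.ι ℂ))) u = _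
  congr 1
  ext x
  simpa using hφ x

end SurfaceAlgebra

/-! ### The cubic algebra in orthonormal generators -/

section Orthonormal

variable {m : ℕ} {A : Type*} [Ring A] [Algebra ℂ A]

/-- The generators `zᵢ = yᵢ₊₁` and `wᵢ = [y₀, yᵢ₊₁]`. -/
def surfaceGen (y : Fin (m + 2) → A) (x : Fin (m + 1) × Bool) : A :=
  if x.2 then ⁅y 0, y x.1.succ⁆ else y x.1.succ

/-- A basis of the algebra with the universal relations `∑ [yᵢ, [yᵢ, yⱼ]] = 0`. -/
theorem exists_basis_of_orthonormal (y : Fin (m + 2) → A)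
    (hy : ∀ j, ∑ i, ⁅y i, ⁅y i, y j⁆⁆ = 0) (hgen : Algebra.adjoin ℂ (Set.range y) = ⊤)
    -- Targets in `Type` suffice: the property is only applied to endomorphisms of `OreSeq
    -- (SurfaceAlgebra m)`.
    (hlift : ∀ (E : Type) [Ring E] [Algebra ℂ E] (Y : Fin (m + 2) → E),
      (∀ j, ∑ i, ⁅Y i, ⁅Y i, Y j⁆⁆ = 0) → ∃ f : A →ₐ[ℂ] E, ∀ i, f (y i) = Y i) :
    ∃ e : Module.Basis ((FreeMonoid (Letter m) × ℕ) × ℕ) ℂ A, ∀ u j n, e ((u, j), n)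
      = FreeMonoid.lift (Letter.value (surfaceGen y)) u * y 1 ^ j * y 0 ^ n := by
  obtain ⟨φ, hφ⟩ := SurfaceAlgebra.exists_lift (surfaceGen y) (by
    have h := hy 0
    rw [Fin.sum_univ_succ] at h
    simp only [surfaceGen, if_true, Bool.false_eq_true, if_false]
    rw [ring_lie_self] at h
    simpa [ring_lie_skew (y 0) (y (Fin.succ _)), ring_lie_self, ring_lie_neg, ring_lie_zero]
      using h)
  let z : Fin (m + 1) → SurfaceAlgebra m := fun i => SurfaceAlgebra.gen (i, false)
  obtain ⟨D, hD, hDgen⟩ := SurfaceAlgebra.exists_derivation (m := m)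
    -- These values are forced: `D` must be the bracket with `y₀`, and the relations for `j ≥ 1`
    -- prescribe `[y₀, wᵢ]`.
    (fun x => if x.2 then -∑ j, ⁅z j, ⁅z j, z x.1⁆⁆ else SurfaceAlgebra.gen (x.1, true)) (by
      have h := sum_sum_lie_lie_lie_eq_zero (k := ℂ) z
      rw [← neg_eq_zero, ← Finset.sum_neg_distrib] at h
      rw [← h]
      refine Finset.sum_congr rfl fun i _ => ?_
      simp only [if_true, Bool.false_eq_true, if_false]
      rw [ring_lie_self, zero_add, ring_lie_neg, ring_lie_sum])
  have hDz : ∀ i, D (z i) = SurfaceAlgebra.gen (i, true) := fun i => by simp [z, hDgen]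
  have hDw : ∀ i, D (SurfaceAlgebra.gen (i, true)) = -∑ j, ⁅z j, ⁅z j, z i⁆⁆ := fun i => by
    simp [hDgen]
  obtain ⟨ρ, hρ⟩ := hlift (Module.End ℂ (OreSeq (SurfaceAlgebra m)))
    (Fin.cons (shiftAdd D) fun i => leftMul ℂ _ (z i)) (by
      have hs : ∀ i, ⁅shiftAdd D, leftMul ℂ _ (z i)⁆ = leftMul ℂ _ (SurfaceAlgebra.gen (i, true)) :=
        fun i => by rw [lie_shiftAdd_leftMul D hD, hDz]
      -- The relation of index `0` reduces to `∑ [zᵢ, wᵢ] = 0`, the others to the value of `D` on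
      -- `wⱼ`.
      refine Fin.cases ?_ fun j => ?_
      · rw [Fin.sum_univ_succ]
        simp only [Fin.cons_zero, Fin.cons_succ]
        rw [ring_lie_self]
        simp only [ring_lie_skew (leftMul ℂ _ (z _)) (shiftAdd D), hs]
        have h := congrArg (leftMul ℂ _) (SurfaceAlgebra.sum_lie_gen (m := m))
        simp only [map_sum, algHom_lie, map_zero] at h
        rw [ring_lie_zero, zero_add]
        simp only [ring_lie_neg, Finset.sum_neg_distrib, z, h, neg_zero]
      · rw [Fin.sum_univ_succ]
        simp only [Fin.cons_zero, Fin.cons_succ]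
        rw [hs, lie_shiftAdd_leftMul D hD, hDw]
        simp only [← algHom_lie, ← map_sum, ← map_add, neg_add_cancel, map_zero])
  have hρ0 : ρ (y 0) = shiftAdd D := hρ 0
  have hρs : ∀ i : Fin (m + 1), ρ (y i.succ) = leftMul ℂ _ (z i) := fun i => hρ i.succ
  have hρφ : ∀ x, ρ (φ x) = leftMul ℂ _ x := by
    have : ρ.comp φ = leftMul ℂ _ := by
      refine SurfaceAlgebra.algHom_ext ?_
      rintro ⟨i, ε⟩
      rw [AlgHom.comp_apply, hφ]
      cases ε
      · exact hρs i
      · simp only [surfaceGen, if_true]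
        rw [algHom_lie, hρ0, hρs, lie_shiftAdd_leftMul D hD, hDz]
    exact fun x => DFunLike.congr_fun this x
  have hφz : ∀ i, φ (z i) = y i.succ := fun i => hφ (i, false)
  have hz : ∀ x, ⁅y 0, φ x⁆ = φ (D x) := by
    refine lie_eq_of_adjoin_eq_top D hD φ _ SurfaceAlgebra.adjoin_range_gen ?_
    rintro _ ⟨⟨i, ε⟩, rfl⟩
    cases ε
    · change ⁅_, φ (z i)⁆ = φ (D (z i))
      rw [hφz, hDz, hφ]
      simp [surfaceGen]
    · rw [hDw, hφ]
      simp only [map_neg, map_sum, algHom_lie, hφz]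
      have h := hy i.succ
      rw [Fin.sum_univ_succ] at h
      exact eq_neg_of_add_eq_zero_left h
  obtain ⟨b, hb⟩ := SurfaceAlgebra.exists_basis m
  obtain ⟨e, he⟩ := exists_basis_of_ore b D hD φ (y 0) hz (by
    rw [eq_top_iff, ← hgen]
    refine Algebra.adjoin_mono ?_
    rintro _ ⟨i, rfl⟩
    exact Fin.cases (Or.inl rfl) (fun i => Or.inr ⟨z i, hφz i⟩) i) ρ hρφ hρ0
  refine ⟨e, fun u j n => ?_⟩
  rw [he, hb, map_mul, map_pow, hφ]
  congr 2
  change ((φ : SurfaceAlgebra m →* A).comp (FreeMonoid.lift _)) u = _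
  congr 1
  ext x
  simp only [MonoidHom.comp_apply, FreeMonoid.lift_eval_of]
  exact (Letter.map_value φ _ x).trans (by simp only [hφ])

end Orthonormal

/-! ### Dimensions from a homogeneous basis -/

section HomogeneousBasis

variable {K A : Type*} [Field K] [AddCommGroup A] [Module K A]

/-- A homogeneous basis restricts to bases of the homogeneous components. -/
theorem eq_span_of_homogeneous_basis (𝒜 : ℕ → Submodule K A) [DirectSum.Decomposition 𝒜]
    {ι : Type*} (e : Module.Basis ι K A) (wt : ι → ℕ) (he : ∀ i, e i ∈ 𝒜 (wt i)) (n : ℕ) :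
    𝒜 n = Submodule.span K (Set.range fun i : {i // wt i = n} => e i) := by
  refine le_antisymm (fun x hx => ?_) (Submodule.span_le.mpr ?_)
  · have key : ∀ x, (DirectSum.decompose 𝒜 x n : A)
        ∈ Submodule.span K (Set.range fun i : {i // wt i = n} => e i) := by
      intro x
      have hx : x ∈ Submodule.span K (Set.range e) := e.span_eq ▸ Submodule.mem_top
      induction hx using Submodule.span_induction with
      | mem x hx =>
        obtain ⟨i, rfl⟩ := hx
        by_cases hi : wt i = n
        · rw [DirectSum.decompose_of_mem_same 𝒜 (hi ▸ he i)]
          exact Submodule.subset_span ⟨⟨i, hi⟩, rfl⟩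
        · rw [DirectSum.decompose_of_mem_ne 𝒜 (he i) hi]
          exact Submodule.zero_mem _
      | zero => simp
      | add x y _ _ hx hy => simpa using Submodule.add_mem _ hx hy
      | smul r x _ hx => 
        rw [DirectSum.decompose_smul]
        exact Submodule.smul_mem _ r hx
    simpa [DirectSum.decompose_of_mem_same 𝒜 hx] using key x
  · rintro _ ⟨⟨i, rfl⟩, rfl⟩
    exact he i

theorem finite_of_homogeneous_basis (𝒜 : ℕ → Submodule K A) [DirectSum.Decomposition 𝒜]
    {ι : Type*} (e : Module.Basis ι K A) (wt : ι → ℕ) (he : ∀ i, e i ∈ 𝒜 (wt i)) (n : ℕ)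
    [Finite {i // wt i = n}] : Module.Finite K (𝒜 n) := by
  rw [eq_span_of_homogeneous_basis 𝒜 e wt he n]
  exact Module.Finite.span_of_finite K (Set.finite_range _)

theorem finrank_of_homogeneous_basis (𝒜 : ℕ → Submodule K A) [DirectSum.Decomposition 𝒜]
    {ι : Type*} (e : Module.Basis ι K A) (wt : ι → ℕ) (he : ∀ i, e i ∈ 𝒜 (wt i)) (n : ℕ)
    [Finite {i // wt i = n}] : Module.finrank K (𝒜 n) = Nat.card {i // wt i = n} := by
  have := Fintype.ofFinite {i // wt i = n}
  rw [eq_span_of_homogeneous_basis 𝒜 e wt he n, Nat.card_eq_fintype_card]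
  exact finrank_span_eq_card (e.linearIndependent.comp _ Subtype.val_injective)

end HomogeneousBasis

/-! ### Degrees of letters and words -/

section Weights

/-- The degree of a letter. -/
def Letter.weight {m : ℕ} : Letter m → ℕ
  | none => 2
  | some (_, ε, n) => n + 1 + ε.toNat

/-- The sum of the degrees of the letters of a word. -/
def wordWeight {X : Type*} (wt : X → ℕ) (u : FreeMonoid X) : ℕ := (u.toList.map wt).sum

variable {m : ℕ} {A : Type*} [Ring A] [Algebra ℂ A] (𝒜 : ℕ → Submodule ℂ A)
  [SetLike.GradedMonoid 𝒜]

theorem lie_mem_graded {i j : ℕ} {a b : A} (ha : a ∈ 𝒜 i) (hb : b ∈ 𝒜 j) : ⁅a, b⁆ ∈ 𝒜 (i + j) :=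
  Submodule.sub_mem _ (SetLike.mul_mem_graded ha hb)
    (add_comm i j ▸ SetLike.mul_mem_graded hb ha)

theorem Letter.value_mem_graded {y : Fin (m + 2) → A} (hy : ∀ i, y i ∈ 𝒜 1) (x : Letter m) :
    x.value (surfaceGen y) ∈ 𝒜 x.weight := by
  have hg : ∀ x : Fin (m + 1) × Bool, surfaceGen y x ∈ 𝒜 (1 + x.2.toNat) := by
    rintro ⟨i, ε⟩
    cases ε
    · simpa [surfaceGen] using hy _
    · simpa [surfaceGen] using lie_mem_graded 𝒜 (hy 0) (hy _)
  rcases x with _ | ⟨i, ε, n⟩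
  · exact hg (0, true)
  · change (fun x => _)^[n] _ ∈ 𝒜 (n + 1 + ε.toNat)
    induction n with
    | zero => simpa using hg (i.succ, ε)
    | succ n ih =>
      rw [Function.iterate_succ_apply']
      have h := lie_mem_graded 𝒜 (hg (0, false)) ih
      have e : 1 + Bool.toNat false + (n + 1 + ε.toNat) = n + 1 + 1 + ε.toNat := by
        simp only [Bool.toNat_false]; ring
      rw [← e]
      exact h

theorem lift_mem_graded {X : Type*} (f : X → A) (wt : X → ℕ) (hf : ∀ x, f x ∈ 𝒜 (wt x))
    (u : FreeMonoid X) : FreeMonoid.lift f u ∈ 𝒜 (wordWeight wt u) := by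
  rw [FreeMonoid.lift_apply]
  exact SetLike.list_prod_map_mem_graded _ _ _ fun x _ => hf x

end Weights

/-! ### Diagonalizing the metric over `ℂ` -/

section ComplexSquareRoot

/-- Over `ℂ`, a real symmetric invertible matrix factors as `M Mᵀ`. -/
theorem exists_mul_transpose_eq {n : Type*} [Fintype n] [DecidableEq n] (g : Matrix n n ℝ)
    (hsymm : g.IsSymm) (hinv : IsUnit g) :
    ∃ M : Matrix n n ℂ, M * M.transpose = g.map Complex.ofRealHom ∧ IsUnit M := by
  have hH : g.IsHermitian := by
    rw [Matrix.IsHermitian, Matrix.conjTranspose_eq_transpose_of_trivial]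
    exact hsymm
  set U : Matrix n n ℝ := (hH.eigenvectorUnitary).1 with hU
  have hspec : g = U * Matrix.diagonal hH.eigenvalues * U.transpose := by
    have h := hH.spectral_theorem
    rw [Unitary.conjStarAlgAut_apply] at h
    simpa [hU, Matrix.star_eq_conjTranspose, Function.comp_def,
      Matrix.conjTranspose_eq_transpose_of_trivial] using h
  -- Eigenvalues may be negative, so their square roots are taken in `ℂ`; this makes the signature
  -- of the metric irrelevant.
  choose r hr using fun i =>
    IsAlgClosed.exists_pow_nat_eq ((hH.eigenvalues i : ℝ) : ℂ) (n := 2) zero_lt_two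
  have hM : (U.map Complex.ofRealHom * Matrix.diagonal r)
      * (U.map Complex.ofRealHom * Matrix.diagonal r).transpose = g.map Complex.ofRealHom := by
    have hd : Matrix.diagonal r * Matrix.diagonal r
        = (Matrix.diagonal hH.eigenvalues).map Complex.ofRealHom := by
      rw [Matrix.diagonal_mul_diagonal, Matrix.diagonal_map (map_zero _)]
      congr 1
      funext i
      rw [← sq, hr]
      rfl
    conv_rhs => rw [hspec]
    rw [Matrix.map_mul, Matrix.map_mul, ← hd, Matrix.transpose_mul, Matrix.diagonal_transpose,
      Matrix.transpose_map]
    simp only [Matrix.mul_assoc]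
  refine ⟨_, hM, ?_⟩
  have hg : IsUnit (g.map Complex.ofRealHom) := hinv.map Complex.ofRealHom.mapMatrix
  rw [← hM, Matrix.isUnit_iff_isUnit_det, Matrix.det_mul] at hg
  rw [Matrix.isUnit_iff_isUnit_det]
  exact isUnit_of_mul_isUnit_left hg

/-- Used in both directions, to pass between the `∇_l` and the orthonormal generators. -/
theorem sum_smul_sum_smul {n E : Type*} [Fintype n] [DecidableEq n] [AddCommGroup E] [Module ℂ E]
    {P Q : Matrix n n ℂ} (h : P * Q = 1) (x : n → E) (i : n) :
    ∑ l, Q l i • ∑ j, P j l • x j = x i := by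
  have hj : ∀ j, ∑ l, Q l i * P j l = if j = i then 1 else 0 := fun j => by
    rw [← Matrix.one_apply, ← h, Matrix.mul_apply]
    exact Finset.sum_congr rfl fun l _ => mul_comm _ _
  simp only [Finset.smul_sum, smul_smul]
  rw [Finset.sum_comm]
  simp [← Finset.sum_smul, hj]

end ComplexSquareRoot

/-! ### Change of generators in the Yang-Mills algebra -/

namespace YangMills

variable {s : ℕ} (g : Matrix (Fin (s + 1)) (Fin (s + 1)) ℝ)

theorem adjoin_range_nabla : Algebra.adjoin ℂ (Set.range (nabla g)) = ⊤ := by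
  have : nabla g = proj g ∘ FreeAlgebra.ι ℂ := rfl
  rw [this, Set.range_comp, ← AlgHom.map_adjoin, FreeAlgebra.adjoin_range_ι, Algebra.map_top,
    AlgHom.range_eq_top]
  exact RingQuot.mkAlgHom_surjective ℂ _

theorem exists_lift {E : Type*} [Ring E] [Algebra ℂ E] (x : Fin (s + 1) → E)
    (hx : ∀ n, cubicElement g x n = 0) : ∃ f : CubicAlgebra g →ₐ[ℂ] E, ∀ l, f (nabla g l) = x l := by
  refine ⟨RingQuot.liftAlgHom ℂ ⟨FreeAlgebra.lift ℂ x, ?_⟩, fun l => ?_⟩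
  · rintro _ _ ⟨n⟩
    rw [map_cubicElement, map_zero, ← hx n]
    congr 1
    exact funext fun l => FreeAlgebra.lift_ι_apply _ _
  · exact (RingQuot.liftAlgHom_mkAlgHom_apply ℂ _ _ _).trans (FreeAlgebra.lift_ι_apply _ _)

variable {g}

theorem cubicElement_eq_sum {M : Matrix (Fin (s + 1)) (Fin (s + 1)) ℂ}
    (hM : M * M.transpose = (g⁻¹).map Complex.ofRealHom) {E : Type*} [Ring E] [Algebra ℂ E]
    (x : Fin (s + 1) → E) (n : Fin (s + 1)) :
    cubicElement g x n = ∑ i, ⁅∑ l, M l i • x l, ⁅∑ l, M l i • x l, x n⁆⁆ := by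
  have hg : ∀ l m, ((g⁻¹ l m : ℝ) : ℂ) = ∑ i, M l i * M m i := fun l m =>
    (congrFun (congrFun hM l) m).symm
  have hlie : ∀ (c : Fin (s + 1) → ℂ) (a : E),
      ⁅∑ l, c l • x l, a⁆ = ∑ l, c l • ⁅x l, a⁆ := fun c a => by
    simp [Ring.lie_def, Finset.sum_mul, Finset.mul_sum, smul_sub]
  simp only [cubicElement, hg, hlie, ring_lie_sum, ring_lie_smul, Finset.smul_sum, Finset.sum_smul,
    smul_smul]
  rw [Finset.sum_comm_cycle]

/-- A homogeneous basis of the cubic Yang-Mills algebra. -/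
theorem exists_homogeneous_basis {m : ℕ} (g : Matrix (Fin (m + 2)) (Fin (m + 2)) ℝ)
    (hsymm : g.IsSymm) (hinv : IsUnit g) :
    ∃ e : Module.Basis ((FreeMonoid (Letter m) × ℕ) × ℕ) ℂ (CubicAlgebra (s := m + 1) g),
      ∀ x, e x ∈ component (s := m + 1) g (wordWeight Letter.weight x.1.1 + x.1.2 + x.2) := by
  obtain ⟨M, hM, hMu⟩ := exists_mul_transpose_eq g⁻¹ (by
    rw [Matrix.IsSymm, Matrix.transpose_nonsing_inv, hsymm]) (by
    rwa [Matrix.isUnit_nonsing_inv_iff])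
  have hMu' := (Matrix.isUnit_iff_isUnit_det _).mp hMu
  let y : Fin (m + 2) → CubicAlgebra (s := m + 1) g := fun i => ∑ l, M l i • nabla g l
  have hy1 : ∀ i, y i ∈ component (s := m + 1) g 1 := fun i =>
    Submodule.sum_mem _ fun l _ => Submodule.smul_mem _ _ (nabla_mem g l)
  have hnabla : ∀ i, ∑ l, M⁻¹ l i • y l = nabla g i :=
    sum_smul_sum_smul (Matrix.mul_nonsing_inv M hMu') (nabla g)
  have hlift : ∀ (E : Type) [Ring E] [Algebra ℂ E] (Y : Fin (m + 2) → E),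
      (∀ j, ∑ i, ⁅Y i, ⁅Y i, Y j⁆⁆ = 0) → ∃ f : CubicAlgebra (s := m + 1) g →ₐ[ℂ] E,
        ∀ i, f (y i) = Y i := by
    intro E _ _ Y hY
    have hYx := sum_smul_sum_smul (Matrix.nonsing_inv_mul M hMu') Y
    obtain ⟨f, hf⟩ := exists_lift (s := m + 1) g (fun l => ∑ j, M⁻¹ j l • Y j) fun n => by
      rw [cubicElement_eq_sum hM]
      simp only [hYx, ring_lie_sum, ring_lie_smul]
      rw [Finset.sum_comm]
      simp only [← Finset.smul_sum, hY, smul_zero, Finset.sum_const_zero]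
    exact ⟨f, fun i => by simp only [y, map_sum, map_smul, hf, hYx]⟩
  have hrel : ∀ j, ∑ i, ⁅y i, ⁅y i, y j⁆⁆ = 0 := by
    intro j
    -- The relations are linear in the innermost entry, so that entry may be changed from `∇_n` to
    -- `y j` separately.
    have h : ∀ n, ∑ i, ⁅y i, ⁅y i, nabla g n⁆⁆ = 0 := fun n => by
      rw [← cubicElement_nabla (s := m + 1) g n, cubicElement_eq_sum hM]
    change ∑ i, ⁅y i, ⁅y i, ∑ l, M l j • nabla g l⁆⁆ = 0
    simp only [ring_lie_sum, ring_lie_smul]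
    rw [Finset.sum_comm]
    simp only [← Finset.smul_sum, h, smul_zero, Finset.sum_const_zero]
  have hgen : Algebra.adjoin ℂ (Set.range y) = ⊤ := by
    rw [eq_top_iff, ← adjoin_range_nabla]
    refine Algebra.adjoin_le ?_
    rintro _ ⟨i, rfl⟩
    rw [SetLike.mem_coe, ← hnabla]
    exact Subalgebra.sum_mem _ fun l _ =>
      Subalgebra.smul_mem _ (Algebra.subset_adjoin (Set.mem_range_self l)) _
  obtain ⟨e, he⟩ := exists_basis_of_orthonormal y hrel hgen hlift
  refine ⟨e, fun ⟨⟨u, j⟩, n⟩ => ?_⟩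
  rw [he]
  have h1 := lift_mem_graded (component (s := m + 1) g) _ _
    (Letter.value_mem_graded (component (s := m + 1) g) hy1) u
  have h2 := SetLike.pow_mem_graded j (hy1 1)
  have h3 := SetLike.pow_mem_graded n (hy1 0)
  simp only [smul_eq_mul, mul_one] at h2 h3
  exact SetLike.mul_mem_graded (SetLike.mul_mem_graded h1 h2) h3

end YangMills

/-! ### Generating functions of weighted sets -/

section GeneratingFunctions

variable {ι κ : Type*}

/-- The generating function of the numbers of elements of given weight. -/
noncomputable def weightSeries (wt : ι → ℕ) : PowerSeries ℚ :=
  PowerSeries.mk fun n => (Nat.card {i // wt i = n} : ℚ)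

theorem weightSeries_fintype [Fintype ι] (wt : ι → ℕ) :
    weightSeries wt = ∑ i, PowerSeries.X ^ wt i := by
  ext n
  rw [weightSeries, PowerSeries.coeff_mk, map_sum, Nat.card_eq_fintype_card, Fintype.card_subtype]
  simp [PowerSeries.coeff_X_pow, eq_comm]

theorem weightSeries_nat : (1 - PowerSeries.X) * weightSeries (id : ℕ → ℕ) = 1 := by
  have h : weightSeries (id : ℕ → ℕ) = PowerSeries.mk 1 := by
    ext n
    simp [weightSeries]
  rw [h, mul_comm, PowerSeries.mk_one_mul_one_sub_eq_one]

theorem weightSeries_equiv (f : ι ≃ κ) (wt : ι → ℕ) (wt' : κ → ℕ) (h : ∀ i, wt' (f i) = wt i) :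
    weightSeries wt = weightSeries wt' := by
  ext n
  simp only [weightSeries, PowerSeries.coeff_mk]
  rw [Nat.card_congr (f.subtypeEquiv (q := fun j => wt' j = n) fun i => by rw [h])]

theorem weightSeries_sum (wt : ι → ℕ) (wt' : κ → ℕ) (h : ∀ n, Finite {i // wt i = n})
    (h' : ∀ n, Finite {i // wt' i = n}) :
    weightSeries (Sum.elim wt wt') = weightSeries wt + weightSeries wt' := by
  ext n
  have : Finite {a // Sum.elim wt wt' (Sum.inl a) = n} := h n
  have : Finite {b // Sum.elim wt wt' (Sum.inr b) = n} := h' n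
  simp only [weightSeries, map_add, PowerSeries.coeff_mk]
  rw [Nat.card_congr (Equiv.subtypeSum (p := fun x => Sum.elim wt wt' x = n)), Nat.card_sum]
  simp

/-- Pairs of total weight `n`, sorted by the weights of the components. -/
def sigmaAntidiagonalEquiv (wt : ι → ℕ) (wt' : κ → ℕ) (n : ℕ) :
    {x : ι × κ // wt x.1 + wt' x.2 = n} ≃
      Σ p : Finset.HasAntidiagonal.antidiagonal n, {i // wt i = p.1.1} × {j // wt' j = p.1.2} where
  toFun x := ⟨⟨(wt x.1.1, wt' x.1.2), Finset.HasAntidiagonal.mem_antidiagonal.mpr x.2⟩, ⟨x.1.1, rfl⟩, ⟨x.1.2, rfl⟩⟩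
  invFun x := ⟨(x.2.1.1, x.2.2.1), by
    rw [x.2.1.2, x.2.2.2]; exact Finset.HasAntidiagonal.mem_antidiagonal.mp x.1.2⟩
  left_inv _ := rfl
  right_inv := by
    rintro ⟨⟨⟨a, b⟩, h⟩, ⟨i, hi⟩, ⟨j, hj⟩⟩
    change wt i = a at hi
    change wt' j = b at hj
    subst hi hj
    rfl

theorem finite_weight_prod (wt : ι → ℕ) (wt' : κ → ℕ) (h : ∀ n, Finite {i // wt i = n})
    (h' : ∀ n, Finite {i // wt' i = n}) (n : ℕ) :
    Finite {x : ι × κ // wt x.1 + wt' x.2 = n} :=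
  Finite.of_equiv _ (sigmaAntidiagonalEquiv wt wt' n).symm

theorem weightSeries_prod (wt : ι → ℕ) (wt' : κ → ℕ) (h : ∀ n, Finite {i // wt i = n})
    (h' : ∀ n, Finite {i // wt' i = n}) :
    weightSeries (fun x : ι × κ => wt x.1 + wt' x.2) = weightSeries wt * weightSeries wt' := by
  ext n
  rw [PowerSeries.coeff_mul]
  simp only [weightSeries, PowerSeries.coeff_mk]
  rw [Nat.card_congr (sigmaAntidiagonalEquiv wt wt' n), Nat.card_sigma]
  simp only [Nat.card_prod]
  push_cast
  exact Finset.sum_coe_sort (Finset.HasAntidiagonal.antidiagonal n) fun p =>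
    (Nat.card {i // wt i = p.1} : ℚ) * (Nat.card {j // wt' j = p.2} : ℚ)

theorem finite_weight_le (wt : ι → ℕ) (h : ∀ n, Finite {i // wt i = n}) (n : ℕ) :
    {i | wt i ≤ n}.Finite := by
  have : {i | wt i ≤ n} = ⋃ j ∈ Set.Iic n, {i | wt i = j} := by ext; simp
  rw [this]
  exact (Set.finite_Iic n).biUnion fun j _ => Set.finite_coe_iff.mp (h j)

theorem wordWeight_of_mul (wt : ι → ℕ) (x : ι) (u : FreeMonoid ι) :
    wordWeight wt (FreeMonoid.of x * u) = wt x + wordWeight wt u := by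
  simp [wordWeight]

theorem finite_wordWeight (wt : ι → ℕ) (h : ∀ n, Finite {i // wt i = n}) (hpos : ∀ i, 0 < wt i)
    (n : ℕ) : Finite {u : FreeMonoid ι // wordWeight wt u = n} := by
  -- Bounded weight is what induction needs: removing the first letter lowers the weight by an
  -- unspecified positive amount.
  suffices hle : {u : FreeMonoid ι | wordWeight wt u ≤ n}.Finite from
    (hle.subset fun u (hu : _ = n) => hu.le : {u | wordWeight wt u = n}.Finite)
  induction n with
  | zero =>
    refine (Set.finite_singleton (1 : FreeMonoid ι)).subset fun u hu => ?_
    induction u using FreeMonoid.casesOn with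
    | one => rfl
    | of_mul x u =>
      rw [Set.mem_ofPred_eq, wordWeight_of_mul] at hu
      have := hpos x
      omega
  | succ n ih =>
    refine ((Set.finite_singleton (1 : FreeMonoid ι)).union
      ((finite_weight_le wt h (n + 1)).image2 (fun x u => FreeMonoid.of x * u) ih)).subset
      fun u hu => ?_
    induction u using FreeMonoid.casesOn with
    | one => exact Or.inl rfl
    | of_mul x u =>
      rw [Set.mem_ofPred_eq, wordWeight_of_mul] at hu
      have := hpos x
      refine Or.inr ⟨x, ?_, u, ?_, rfl⟩ <;> simp only [Set.mem_ofPred_eq] <;> omega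

/-- A word is empty or has a first letter. -/
def wordEquiv (ι : Type*) : FreeMonoid ι ≃ Unit ⊕ ι × FreeMonoid ι where
  toFun u := match u.toList with
    | [] => Sum.inl ()
    | x :: u => Sum.inr (x, FreeMonoid.ofList u)
  invFun := Sum.elim (fun _ => 1) fun p => FreeMonoid.of p.1 * p.2
  left_inv u := by induction u using FreeMonoid.casesOn <;> rfl
  right_inv u := by rcases u with _ | ⟨x, u⟩ <;> rfl

/-- Splitting off the first letter gives `W = 1 + L * W`. -/
theorem weightSeries_word (wt : ι → ℕ) (h : ∀ n, Finite {i // wt i = n}) (hpos : ∀ i, 0 < wt i) :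
    weightSeries (wordWeight wt) * (1 - weightSeries wt) = 1 := by
  have hfin := finite_wordWeight wt h hpos
  have key : weightSeries (wordWeight wt) = 1 + weightSeries wt * weightSeries (wordWeight wt) := by
    conv_lhs => rw [weightSeries_equiv (wordEquiv ι) (wordWeight wt)
      (Sum.elim (fun _ => 0) fun p => wt p.1 + wordWeight wt p.2) fun u => by
        induction u using FreeMonoid.casesOn <;> rfl]
    rw [weightSeries_sum _ _ (fun n => inferInstance) (finite_weight_prod _ _ h hfin),
      weightSeries_prod _ _ h hfin, weightSeries_fintype]
    simp
  linear_combination key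

end GeneratingFunctions

/-! ### The series of the basis -/

section LetterSeries

variable (m : ℕ)

theorem Letter.weight_pos (x : Letter m) : 0 < x.weight := by
  rcases x with _ | ⟨i, ε, n⟩ <;> simp only [Letter.weight] <;> omega

/-- The weight series of the letters, up to the factor `1 - X`. -/
theorem one_sub_X_mul_weightSeries_letter :
    (∀ n, Finite {x : Letter m // x.weight = n}) ∧
    (1 - PowerSeries.X) * weightSeries (Letter.weight (m := m)) =
      (1 - PowerSeries.X) * PowerSeries.X ^ 2
        + (m : PowerSeries ℚ) * (PowerSeries.X + PowerSeries.X ^ 2) := by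
  let wb : Fin m × Bool → ℕ := fun x => 1 + x.2.toNat
  have hnat : ∀ n, Finite {i : ℕ // id i = n} := fun n => by
    simp only [id]; infer_instance
  let f : Letter m ≃ Unit ⊕ (Fin m × Bool) × ℕ :=
    ((Equiv.optionEquivSumPUnit _).trans (Equiv.sumComm _ _)).trans
      (Equiv.sumCongr (Equiv.refl _) (Equiv.prodAssoc _ _ _).symm)
  let wt' : Unit ⊕ (Fin m × Bool) × ℕ → ℕ :=
    Sum.elim (fun _ => 2) fun x => wb x.1 + id x.2
  have hf : ∀ x, wt' (f x) = Letter.weight x := by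
    rintro (_ | ⟨i, ε, n⟩)
    · rfl
    · change 1 + ε.toNat + n = n + 1 + ε.toNat
      ring
  have hprod := finite_weight_prod wb id (fun n => inferInstance) hnat
  refine ⟨fun n => ?_, ?_⟩
  · have h1 : Finite {x // wt' x = n} := by
      have h2 : Finite {a // wt' (Sum.inl a) = n} := inferInstance
      have h3 : Finite {b // wt' (Sum.inr b) = n} := hprod n
      exact Finite.of_equiv _ (Equiv.subtypeSum (p := fun x => wt' x = n)).symm
    exact Finite.of_equiv _ (f.subtypeEquiv (p := fun x => x.weight = n)
      (q := fun x => wt' x = n) fun x => by rw [hf]).symm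
  · rw [weightSeries_equiv f _ wt' hf, weightSeries_sum _ _ (fun n => inferInstance) hprod,
      weightSeries_prod _ _ (fun n => inferInstance) hnat, weightSeries_fintype,
      weightSeries_fintype, Fintype.sum_prod_type]
    simp only [Finset.univ_unique, Finset.card_singleton, Nat.cast_one, wb, Fintype.sum_bool, Finset.sum_const,
      Finset.card_univ, Fintype.card_fin, nsmul_eq_mul, Bool.toNat_true, Bool.toNat_false]
    linear_combination (m : PowerSeries ℚ) * (PowerSeries.X + PowerSeries.X ^ 2) * weightSeries_nat

/-- The weight of an element of the homogeneous basis. -/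
def basisWeight (x : (FreeMonoid (Letter m) × ℕ) × ℕ) : ℕ :=
  wordWeight Letter.weight x.1.1 + x.1.2 + x.2

theorem weightSeries_basisWeight :
    (∀ n, Finite {x // basisWeight m x = n}) ∧
    weightSeries (basisWeight m) * ((1 - PowerSeries.X ^ 2) *
      (1 - ((m : PowerSeries ℚ) + 2) * PowerSeries.X + PowerSeries.X ^ 2)) = 1 := by
  obtain ⟨hL, hLs⟩ := one_sub_X_mul_weightSeries_letter m
  have hnat : ∀ n, Finite {i : ℕ // id i = n} := fun n => by
    simp only [id]; infer_instance
  have hW := finite_wordWeight _ hL (Letter.weight_pos m)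
  have hWs := weightSeries_word _ hL (Letter.weight_pos m)
  have h1 := finite_weight_prod (wordWeight Letter.weight) id hW hnat
  have h2 := finite_weight_prod (fun x : FreeMonoid (Letter m) × ℕ =>
    wordWeight Letter.weight x.1 + id x.2) id h1 hnat
  refine ⟨h2, ?_⟩
  have e : weightSeries (basisWeight m)
      = weightSeries (wordWeight (Letter.weight (m := m))) * weightSeries (id : ℕ → ℕ)
        * weightSeries (id : ℕ → ℕ) := by
    rw [← weightSeries_prod _ _ hW hnat, ← weightSeries_prod _ _ h1 hnat]
    rfl
  rw [e]
  have hN := weightSeries_nat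
  set W := weightSeries (wordWeight (Letter.weight (m := m)))
  set N := weightSeries (id : ℕ → ℕ)
  set L := weightSeries (Letter.weight (m := m))
  -- Multiplying the letter identity by `1 - X` clears denominators: `(1 - X)(1 - L) = (1 + X)(1 -
  -- (m + 2) X + X²)`.
  have hX : (1 - PowerSeries.X ^ 2) *
      (1 - ((m : PowerSeries ℚ) + 2) * PowerSeries.X + PowerSeries.X ^ 2)
      = (1 - PowerSeries.X) ^ 2 * (1 - L) := by
    linear_combination (1 - PowerSeries.X) * hLs
  rw [hX]
  calc W * N * N * ((1 - PowerSeries.X) ^ 2 * (1 - L))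
      = ((1 - PowerSeries.X) * N) ^ 2 * (W * (1 - L)) := by ring
    _ = 1 := by rw [hN, hWs]; ring

end LetterSeries

/-! ### Growth of the coefficients -/

section Growth

/-- The recurrence for the coefficients `d n` of `1 / ((1 - X²)(1 - a X + X²))`, in terms of those
of `1 / (1 - a X + X²)`. -/
theorem exists_recurrence {d : ℕ → ℝ} {a : ℝ}
    (h : PowerSeries.mk d * ((1 - PowerSeries.X ^ 2) *
      (1 - PowerSeries.C a * PowerSeries.X + PowerSeries.X ^ 2)) = 1) :
    ∃ e : ℕ → ℝ, e 0 = 1 ∧ e 1 = a ∧ (∀ n, e (n + 2) = a * e (n + 1) - e n) ∧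
      d 0 = e 0 ∧ d 1 = e 1 ∧ ∀ n, d (n + 2) = e (n + 2) + d n := by
  set E := PowerSeries.mk d * (1 - PowerSeries.X ^ 2) with hE
  have h1 : E = 1 + PowerSeries.C a * (PowerSeries.X * E) - PowerSeries.X ^ 2 * E := by
    linear_combination h
  have h2 : PowerSeries.mk d = E + PowerSeries.X ^ 2 * PowerSeries.mk d := by
    rw [hE]; ring
  have hX0 : ∀ F : PowerSeries ℝ, PowerSeries.coeff 0 (PowerSeries.X ^ 2 * F) = 0 := fun F => by
    simp [PowerSeries.coeff_X_pow_mul']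
  have hX1 : ∀ F : PowerSeries ℝ, PowerSeries.coeff 1 (PowerSeries.X ^ 2 * F) = 0 := fun F => by
    simp [PowerSeries.coeff_X_pow_mul']
  have hX2 : ∀ (F : PowerSeries ℝ) n, PowerSeries.coeff (n + 2) (PowerSeries.X ^ 2 * F)
      = PowerSeries.coeff n F := fun F n => PowerSeries.coeff_X_pow_mul F 2 n
  have hY : ∀ (F : PowerSeries ℝ) n, PowerSeries.coeff (n + 1) (PowerSeries.X * F)
      = PowerSeries.coeff n F := fun F n => PowerSeries.coeff_succ_X_mul n F
  have e0 : PowerSeries.coeff 0 E = 1 := by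
    conv_lhs => rw [h1]
    simp only [map_sub, map_add, PowerSeries.coeff_C_mul, hX0]
    simp
  refine ⟨fun n => PowerSeries.coeff n E, e0, ?_, fun n => ?_, ?_, ?_, fun n => ?_⟩
  · beta_reduce
    conv_lhs => rw [h1]
    simp only [map_sub, map_add, PowerSeries.coeff_C_mul, hX1]
    rw [hY E 0, e0]
    simp [PowerSeries.coeff_one]
  · beta_reduce
    conv_lhs => rw [h1]
    simp only [map_sub, map_add, PowerSeries.coeff_C_mul, hX2]
    rw [hY E (n + 1)]
    simp [PowerSeries.coeff_one]
  · simpa [hX0] using congrArg (PowerSeries.coeff 0) h2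
  · simpa [hX1] using congrArg (PowerSeries.coeff 1) h2
  · simpa [hX2] using congrArg (PowerSeries.coeff (n + 2)) h2

theorem exponential_bounds {d e : ℕ → ℝ} {a : ℝ} (ha : 3 ≤ a) (e0 : e 0 = 1) (e1 : e 1 = a)
    (he : ∀ n, e (n + 2) = a * e (n + 1) - e n) (d0 : d 0 = e 0) (d1 : d 1 = e 1)
    (hd : ∀ n, d (n + 2) = e (n + 2) + d n) (n : ℕ) : 2 ^ n ≤ d n ∧ d n ≤ (a + 1) ^ n := by
  -- The ratio bound propagates since `a * e (n + 1) - e n ≥ (3 - 1/2) * e (n + 1)` when `a ≥ 3`.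
  have hmain : ∀ n, 2 ^ n ≤ e n ∧ 2 * e n ≤ e (n + 1) ∧ e (n + 1) ≤ a * e n := by
    intro n
    induction n with
    | zero => rw [e0, e1]; norm_num; linarith
    | succ n ih =>
      obtain ⟨h1, h2, h3⟩ := ih
      have h0 : (0 : ℝ) < 2 ^ n := by positivity
      refine ⟨by rw [pow_succ]; linarith, ?_, ?_⟩
      · rw [he]; nlinarith
      · rw [he]; linarith
  have hle : ∀ n, e n ≤ a ^ n := by
    intro n
    induction n with
    | zero => simp [e0]
    | succ n ih =>
      rw [pow_succ']
      exact (hmain n).2.2.trans (mul_le_mul_of_nonneg_left ih (by linarith))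
  induction n using Nat.twoStepInduction with
  | zero => simp [d0, e0]
  | one => simp only [d1, e1, pow_one]; constructor <;> linarith
  | more n ih1 ih2 =>
    rw [hd]
    have hn : (0 : ℝ) < 2 ^ n := by positivity
    refine ⟨by linarith [(hmain (n + 2)).1, ih1.1], ?_⟩
    -- The base `a + 1` leaves room for the extra term `d n`, as `a (a + 1)ⁿ⁺¹ + (a + 1)ⁿ⁺¹ = (a +
    -- 1)ⁿ⁺²`.
    have h1 : a ^ (n + 2) ≤ a * (a + 1) ^ (n + 1) := by
      rw [pow_succ' a (n + 1)]
      gcongr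
      linarith
    have h2 : (a + 1) ^ n ≤ (a + 1) ^ (n + 1) := pow_le_pow_right₀ (by linarith) n.le_succ
    rw [pow_succ' (a + 1) (n + 1)]
    linarith [hle (n + 2), ih1.2]

theorem polynomial_bound {d e : ℕ → ℝ} (e0 : e 0 = 1) (e1 : e 1 = 2)
    (he : ∀ n, e (n + 2) = 2 * e (n + 1) - e n) (d0 : d 0 = e 0) (d1 : d 1 = e 1)
    (hd : ∀ n, d (n + 2) = e (n + 2) + d n) (n : ℕ) : d n ≤ ((n : ℝ) + 1) ^ 2 := by
  -- For `a = 2` the characteristic polynomial has the double root `1`, so `e` is linear.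
  have hmain : ∀ n : ℕ, e n = n + 1 := by
    intro n
    induction n using Nat.twoStepInduction with
    | zero => simp [e0]
    | one => rw [e1]; norm_num
    | more n ih1 ih2 => rw [he, ih1, ih2]; push_cast; ring
  induction n using Nat.twoStepInduction with
  | zero => simp [d0, e0]
  | one => rw [d1, e1]; norm_num
  | more n ih1 ih2 =>
    rw [hd, hmain]
    have : (0 : ℝ) ≤ n := n.cast_nonneg
    push_cast
    nlinarith

end Growth

/-! ### Poincaré series and growth -/

theorem corollary3 (s : ℕ) (hs : 1 ≤ s) (g : Matrix (Fin (s + 1)) (Fin (s + 1)) ℝ)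
    (hsymm : g.IsSymm) (hinv : IsUnit g) :
    (∀ n : ℕ, Module.Finite ℂ (YangMills.component g n)) ∧
    poincareSeries (YangMills.component g) =
      ((1 - PowerSeries.X ^ 2) *
        (1 - PowerSeries.C ((s : ℚ) + 1) * PowerSeries.X + PowerSeries.X ^ 2))⁻¹ ∧
    (2 ≤ s → HasExponentialGrowth (YangMills.component g)) ∧
    (s = 1 → HasPolynomialGrowth (YangMills.component g)) := by
  -- Two generators, `y₀` and `z₀ = y₁`, are split off, leaving `m` indices for the letters.
  obtain ⟨m, rfl⟩ : ∃ m, s = m + 1 := ⟨s - 1, by omega⟩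
  obtain ⟨e, he⟩ := YangMills.exists_homogeneous_basis g hsymm hinv
  obtain ⟨hfin, hser⟩ := weightSeries_basisWeight m
  have hdim : ∀ n, Module.finrank ℂ (YangMills.component g n) = Nat.card {x // basisWeight m x = n} :=
    fun n => finrank_of_homogeneous_basis _ e (basisWeight m) he n
  have hp : poincareSeries (YangMills.component g) = weightSeries (basisWeight m) := by
    ext n
    simp [poincareSeries, weightSeries, hdim]
  have hmul : poincareSeries (YangMills.component g) * ((1 - PowerSeries.X ^ 2) *
        (1 - PowerSeries.C (((m + 1 : ℕ) : ℚ) + 1) * PowerSeries.X + PowerSeries.X ^ 2)) = 1 := by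
    rw [hp, ← hser]
    congr 4
    simp only [map_add, map_one, map_natCast]
    push_cast
    ring
  have hreal := congrArg (PowerSeries.map (algebraMap ℚ ℝ)) hmul
  have hmk : PowerSeries.map (algebraMap ℚ ℝ) (poincareSeries (YangMills.component g))
      = PowerSeries.mk fun n => (Module.finrank ℂ (YangMills.component g n) : ℝ) := by
    ext n
    simp [poincareSeries]
  simp only [map_mul, map_sub, map_add, map_one, map_pow, PowerSeries.map_X, map_natCast, hmk]
    at hreal
  obtain ⟨f, f0, f1, hf, d0, d1, hd⟩ := exists_recurrence
    (d := fun n => (Module.finrank ℂ (YangMills.component g n) : ℝ))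
    (a := ((m + 1 : ℕ) : ℝ) + 1) (by
      simpa only [map_add, map_one, map_natCast] using hreal)
  refine ⟨fun n => finite_of_homogeneous_basis _ e (basisWeight m) he n, ?_, fun h2 => ?_,
    fun h1 => ?_⟩
  -- The constant coefficient is `1`, so the formal inverse is genuine.
  · rw [PowerSeries.eq_inv_iff_mul_eq_one (by simp)]
    exact hmul
  · have ha : (3 : ℝ) ≤ ((m + 1 : ℕ) : ℝ) + 1 := by
      have : (2 : ℝ) ≤ ((m + 1 : ℕ) : ℝ) := by exact_mod_cast h2
      linarith
    exact ⟨2, _, one_lt_two, Filter.Eventually.of_forall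
      (exponential_bounds ha f0 f1 hf d0 d1 hd)⟩
  · have ha : ((m + 1 : ℕ) : ℝ) + 1 = 2 := by rw [h1]; norm_num
    rw [ha] at f1 hf
    refine ⟨1, 2, fun n => ?_⟩
    rw [one_mul]
    exact polynomial_bound (d := fun n => (Module.finrank ℂ (YangMills.component g n) : ℝ))
      f0 f1 hf d0 d1 hd n
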